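/- Let $H\neq\{0\}$ be a real Hilbert space and $T>0$. For a closed set $K\subseteq H$ and $y\in H$ put $d_K(y):=\inf_{z\in K}\|z-y\|$ and $\mathrm{Proj}_K(y):=\{x\in K:\ \|x-y\|=d_K(y)\}$. For $0<r<\infty$ the closed set $K$ is called $r$-prox-regular if for every $y\in H$ with $0<d_K(y)<r$ one has $\mathrm{Proj}_K(y)\neq\emptyset$ and $x\in \mathrm{Proj}_K\big(x+r\frac{y-x}{\|y-x\|}\big)$ for all $x\in\mathrm{Proj}_K(y)$. Let $Z\subseteq H$ be $r$-prox-regular for some $r>0$. For a continuous function of bounded variation $u\in C([0,T];H)\cap BV([0,T];H)$ and $z_0\in Z$, the play problem asks for $y\in C([0,T];H)\cap BV([0,T];H)$ such that $$u(t)-y(t)\in Z\quad\forall t\in[0,T],\qquad u(0)-y(0)=z_0,$$ $$\int_{[0,T]}\langle z(t)-u(t)+y(t),\,dDy(t)\rangle\le\frac1{2r}\int_{[0,T]}\|z(t)-u(t)+y(t)\|^2\,d|Dy|(t)$$ for every $z\in BV([0,T];H)$ with $z([0,T])\subseteq Z$, where $Dy$ is the ($H$-valued) Lebesgue--Stieltjes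 measure of $y$ on $[0,T]$ and $|Dy|$ is its total variation measure. It is known that this problem has exactly one solution; it is denoted by $P(u,z_0)$, and $P$ is called the (non-convex) play operator. **Theorem.** The play operator is rate independent: let $u\in C([0,T];H)\cap BV([0,T];H)$, $z_0\in Z$, and let $\varphi:[0,T]\to[0,T]$ be continuous, nondecreasing and surjective. If $y$ is a solution of the play problem for $(u,z_0)$, then $y = P(u,z_0)$ and $y\circ\varphi$ is a solution of the play problem for $(u\circ\varphi,z_0)$; and $$P(u\circ\varphi,z_0)=P(u,z_0)\circ\varphi .$$ -/

import Mathlib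

open MeasureTheory Set

/-- The set of projections of `y` onto `K`: the points of `K` at minimal distance from `y`. -/
def projSet {H : Type*} [NormedAddCommGroup H] (K : Set H) (y : H) : Set H :=
  {x | x ∈ K ∧ ‖x - y‖ = Metric.infDist y K}

/-- `K` is an `r`-prox-regular subset of `H`, for a real number `r > 0`. -/
structure IsProxRegular {H : Type*} [NormedAddCommGroup H] [InnerProductSpace ℝ H]
    (r : ℝ) (K : Set H) : Prop where
  pos : 0 < r
  isClosed : IsClosed K
  nonempty_projSet : ∀ y : H, 0 < Metric.infDist y K → Metric.infDist y K < r →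
    (projSet K y).Nonempty
  mem_projSet : ∀ y : H, 0 < Metric.infDist y K → Metric.infDist y K < r →
    ∀ x ∈ projSet K y, x ∈ projSet K (x + r • (‖y - x‖⁻¹ • (y - x)))

/-- The space `C([0,T]; H) ∩ BV([0,T]; H)`. -/
@[ext]
structure CBV (T : ℝ) (H : Type*) [NormedAddCommGroup H] where
  toFun : Icc (0 : ℝ) T → H
  continuous : Continuous toFun
  boundedVariation : BoundedVariationOn toFun univ

namespace CBV

instance {T : ℝ} {H : Type*} [NormedAddCommGroup H] :
    CoeFun (CBV T H) (fun _ => Icc (0 : ℝ) T → H) := ⟨CBV.toFun⟩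

/-- The zero function; it only serves as a default value. -/
instance {T : ℝ} {H : Type*} [NormedAddCommGroup H] : Inhabited (CBV T H) :=
  ⟨⟨fun _ => 0, continuous_const, by
    have h : eVariationOn (fun _ : Icc (0 : ℝ) T => (0 : H)) univ = 0 :=
      eVariationOn.constant_on (by rintro _ ⟨_, _, rfl⟩ _ ⟨_, _, rfl⟩; rfl)
    simp [BoundedVariationOn, h]⟩⟩

/-- The composition `u ∘ φ` with a continuous nondecreasing map `φ : [0,T] → [0,T]`. -/
def comp {T : ℝ} {H : Type*} [NormedAddCommGroup H] (u : CBV T H)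
    (φ : Icc (0 : ℝ) T → Icc (0 : ℝ) T) (hc : Continuous φ) (hm : Monotone φ) : CBV T H where
  toFun := u ∘ φ
  continuous := u.continuous.comp hc
  boundedVariation := ne_top_of_le_ne_top u.boundedVariation
    (eVariationOn.comp_le_of_monotoneOn u φ (hm.monotoneOn univ) (mapsTo_univ φ univ))

instance compactIccSpace_Icc (T : ℝ) : CompactIccSpace (Icc (0 : ℝ) T) :=
  ⟨fun {_ _} => isClosed_Icc.isCompact⟩

/-- The differential measure `Dy` of `y`: the `H`-valued Lebesgue-Stieltjes measure on the Borel
sets of `[0,T]`. -/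
noncomputable def D {T : ℝ} {H : Type*} [NormedAddCommGroup H] [CompleteSpace H]
    (y : CBV T H) : VectorMeasure (Icc (0 : ℝ) T) H :=
  y.boundedVariation.vectorMeasure

end CBV

/-- `y ∈ C([0,T]; H) ∩ BV([0,T]; H)` solves the play problem with characteristic set `Z`, constant
`r`, input `u` and initial state `z₀`. -/
structure IsPlaySolution {T : ℝ} (hT : 0 < T) {H : Type*} [NormedAddCommGroup H]
    [InnerProductSpace ℝ H] [CompleteSpace H] (r : ℝ) (Z : Set H)
    (u : CBV T H) (z₀ : H) (y : CBV T H) : Prop where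
  constraint : ∀ t, u t - y t ∈ Z
  variational_ineq : ∀ z : Icc (0 : ℝ) T → H, BoundedVariationOn z univ → (∀ t, z t ∈ Z) →
    y.D.integral (fun t => z t - u t + y t) (innerSL ℝ)
      ≤ 1 / (2 * r) * ∫ t, ‖z t - u t + y t‖ ^ 2 ∂y.D.variation
  initial : u ⟨0, le_rfl, hT.le⟩ - y ⟨0, le_rfl, hT.le⟩ = z₀

open Classical in
/-- The play operator `(u, z₀) ↦ P(u, z₀)`: the unique solution of the play problem. (The default
value only serves to make the definition total; the problem has exactly one solution whenever `Z`
is `r`-prox-regular.) -/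
noncomputable def play {T : ℝ} (hT : 0 < T) {H : Type*} [NormedAddCommGroup H]
    [InnerProductSpace ℝ H] [CompleteSpace H] (r : ℝ) (Z : Set H)
    (u : CBV T H) (z₀ : Z) : CBV T H :=
  if h : ∃! y, IsPlaySolution hT r Z u z₀ y then h.choose else default

/-!
Let `ψ` be the section `s ↦ min (φ ⁻¹' {s})` of `φ`. It is the lower adjoint of `φ`, so that the
preimage of `[0, t]` under `ψ` is `[0, φ t]`, and comparing the masses of these intervals shows that
`D(y ∘ φ)` is the image of `Dy` under `ψ`, while `Dy` is the image of `D(y ∘ φ)` under `φ`. Taking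
images does not increase the variation, and here it is done in both directions, so the variation
measures correspond in the same way (`CBV.variation_D_eq_map`, `CBV.variation_D_comp`). By the change
of variables formula, testing `y ∘ φ` with `z` amounts to testing `y` with `z ∘ ψ`, and testing `y`
with `z` amounts to testing `y ∘ φ` with `z ∘ φ`. Hence `y` solves the play problem for `u` if and
only if `y ∘ φ` solves it for `u ∘ φ` (`IsPlaySolution.comp`, `IsPlaySolution.of_comp`).

Solutions are unique (`IsPlaySolution.unique`). The variational inequality localizes to intervals
`(s, t]`; adding the inequalities for two solutions, each tested with the other, and using the chain
rule `⟨w, Dw⟩ = D(‖w‖ ^ 2 / 2)` for the difference `w` of the solutions gives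
`‖w t‖ ^ 2 - ‖w s‖ ^ 2 ≤ ∫ ‖w‖ ^ 2 dμ` over `(s, t]` for a finite measure `μ`, and a Gronwall argument
yields `w = 0`. The same comparison, with a constant function in place of the second solution, shows
that a solution is at rest as long as its input is (`IsPlaySolution.eq_of_input_eq`). So every
solution for `u ∘ φ` is constant on the level sets of `φ` and is of the form `y ∘ φ`. Consequently
the problems for `u` and for `u ∘ φ` are solvable simultaneously, with corresponding solutions, which
is why the identity between the play operators needs no existence theorem.
-/

open scoped Topology

/-! ### Functions of bounded variation -/

section BoundedVariation

variable {α E F G K : Type*} [LinearOrder α]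

theorem boundedVariationOn_of_edist_le [PseudoEMetricSpace E] [PseudoEMetricSpace F]
    [PseudoEMetricSpace G] [PseudoEMetricSpace K] {f : α → E} {g : α → F} {k : α → G} {h : α → K}
    {s : Set α} (hf : BoundedVariationOn f s) (hg : BoundedVariationOn g s)
    (hk : BoundedVariationOn k s)
    (H : ∀ x ∈ s, ∀ y ∈ s, x ≤ y →
      edist (h y) (h x) ≤ edist (f y) (f x) + edist (g y) (g x) + edist (k y) (k x)) :
    BoundedVariationOn h s := by
  refine ne_top_of_le_ne_top (ENNReal.add_ne_top.2 ⟨ENNReal.add_ne_top.2 ⟨hf, hg⟩, hk⟩)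
    (iSup_le fun p => ?_)
  calc ∑ i ∈ Finset.range p.1, edist (h (p.2.1 (i + 1))) (h (p.2.1 i))
      ≤ ∑ i ∈ Finset.range p.1, (edist (f (p.2.1 (i + 1))) (f (p.2.1 i))
          + edist (g (p.2.1 (i + 1))) (g (p.2.1 i)) + edist (k (p.2.1 (i + 1))) (k (p.2.1 i))) :=
        Finset.sum_le_sum fun i _ =>
          H _ (p.2.2.2 i) _ (p.2.2.2 (i + 1)) (p.2.2.1 (Nat.le_succ i))
    _ ≤ _ := by
        rw [Finset.sum_add_distrib, Finset.sum_add_distrib]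
        gcongr <;> exact eVariationOn.sum_le p.2.2.1 p.2.2.2

theorem BoundedVariationOn.fun_sub [SeminormedAddCommGroup E] {f g : α → E} {s : Set α}
    (hf : BoundedVariationOn f s) (hg : BoundedVariationOn g s) :
    BoundedVariationOn (fun x => f x - g x) s :=
  boundedVariationOn_of_edist_le hf hg hg fun x _ y _ _ =>
    le_trans (by
      simp only [edist_eq_enorm_sub, sub_sub_sub_comm (f y)]
      exact enorm_sub_le) le_self_add

theorem BoundedVariationOn.fun_add [SeminormedAddCommGroup E] {f g : α → E} {s : Set α}
    (hf : BoundedVariationOn f s) (hg : BoundedVariationOn g s) :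
    BoundedVariationOn (fun x => f x + g x) s :=
  boundedVariationOn_of_edist_le hf hg hg fun _ _ _ _ _ =>
    (edist_add_add_le _ _ _ _).trans le_self_add

theorem boundedVariationOn_const [PseudoEMetricSpace E] (c : E) (s : Set α) :
    BoundedVariationOn (fun _ => c) s := by
  have h : eVariationOn (fun _ : α => c) s = 0 :=
    eVariationOn.constant_on (by rintro _ ⟨_, _, rfl⟩ _ ⟨_, _, rfl⟩; rfl)
  simp [BoundedVariationOn, h]

theorem BoundedVariationOn.comp_monotone {β : Type*} [LinearOrder β] [PseudoEMetricSpace E]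
    {f : α → E} (hf : BoundedVariationOn f univ) {φ : β → α} (hφ : Monotone φ) :
    BoundedVariationOn (f ∘ φ) univ :=
  ne_top_of_le_ne_top hf
    (eVariationOn.comp_le_of_monotoneOn f φ (hφ.monotoneOn univ) (mapsTo_univ φ univ))

theorem BoundedVariationOn.exists_norm_le [SeminormedAddCommGroup E] {f : α → E}
    (hf : BoundedVariationOn f univ) : ∃ C, ∀ x, ‖f x‖ ≤ C := by
  rcases isEmpty_or_nonempty α with h | ⟨⟨a⟩⟩
  · exact ⟨0, fun x => isEmptyElim x⟩
  refine ⟨‖f a‖ + (eVariationOn f univ).toReal, fun x => ?_⟩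
  have h := hf.dist_le (mem_univ x) (mem_univ a)
  rw [dist_eq_norm] at h
  linarith [norm_le_norm_add_norm_sub' (f x) (f a)]

open Classical in
theorem BoundedVariationOn.piecewise_Iic [SeminormedAddCommGroup E] {f g : α → E}
    (hf : BoundedVariationOn f univ) (hg : BoundedVariationOn g univ) (s : α) :
    BoundedVariationOn ((Iic s).piecewise f g) univ := by
  obtain ⟨C, hC⟩ := hf.exists_norm_le
  obtain ⟨C', hC'⟩ := hg.exists_norm_le
  have hCC : 0 ≤ C + C' := by
    linarith [(norm_nonneg _).trans (hC s), (norm_nonneg _).trans (hC' s)]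
  -- the jump across `s` is controlled by the variation of a real-valued step function
  set k : α → ℝ := fun x => if x ≤ s then 0 else C + C' with hk
  have hkm : Monotone k := by
    intro x y hxy
    simp only [hk]
    split_ifs with h1 h2 h2
    · exact le_rfl
    · exact hCC
    · exact absurd (hxy.trans h2) h1
    · exact le_rfl
  have hkb : BoundedVariationOn k univ :=
    (hkm.monotoneOn univ).boundedVariationOn (C := C + C') fun x _ => by
      simp only [hk]
      split_ifs
      · simpa using hCC
      · rw [abs_of_nonneg hCC]
  refine boundedVariationOn_of_edist_le hf hg hkb fun x _ y _ hxy => ?_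
  by_cases h1 : y ≤ s
  · have h2 : x ≤ s := hxy.trans h1
    simp only [piecewise, mem_Iic, h1, h2, if_true]
    rw [add_assoc]
    exact le_self_add
  by_cases h2 : x ≤ s
  · simp only [piecewise, mem_Iic, h1, h2, if_true, if_false, hk]
    refine le_trans ?_ le_add_self
    rw [edist_dist, edist_dist]
    refine ENNReal.ofReal_le_ofReal ?_
    rw [dist_eq_norm, Real.dist_eq, sub_zero, abs_of_nonneg hCC]
    linarith [norm_sub_le (g y) (f x), hC x, hC' y]
  · simp only [piecewise, mem_Iic, h1, h2, if_false]
    rw [add_assoc]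
    exact le_self_add.trans le_add_self

open Classical in
theorem BoundedVariationOn.piecewise_Ioc [SeminormedAddCommGroup E] {f g : α → E}
    (hf : BoundedVariationOn f univ) (hg : BoundedVariationOn g univ) (s t : α) :
    BoundedVariationOn ((Ioc s t).piecewise f g) univ := by
  convert hg.piecewise_Iic (hf.piecewise_Iic hg t) s using 1
  ext x
  by_cases h1 : x ≤ s <;> by_cases h2 : x ≤ t <;> simp [piecewise, h1, h2, not_lt.2, not_le.1]

/-- A function of bounded variation is a Lipschitz function of its variation function, which is
monotone; this is why no separability of the target space is needed. -/
theorem BoundedVariationOn.stronglyMeasurable [TopologicalSpace α] [OrderTopology α]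
    [SecondCountableTopology α] [MeasurableSpace α] [BorelSpace α] [NormedAddCommGroup E]
    {f : α → E} (hf : BoundedVariationOn f univ) : StronglyMeasurable f := by
  rcases isEmpty_or_nonempty α with h | ⟨⟨a⟩⟩
  · exact StronglyMeasurable.of_discrete
  set v : α → ℝ := variationOnFromTo f univ a with hv
  have hl := hf.locallyBoundedVariationOn
  have hvm : Monotone v := monotoneOn_univ.1 (variationOnFromTo.monotoneOn hl (mem_univ a))
  have hle : ∀ x y, x ≤ y → dist (f x) (f y) ≤ v y - v x := by
    intro x y hxy
    have h1 := variationOnFromTo.add hl (mem_univ a) (mem_univ x) (mem_univ y)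
    have h2 : v y - v x = (eVariationOn f (univ ∩ Icc x y)).toReal := by
      rw [hv, ← h1, add_sub_cancel_left, variationOnFromTo.eq_of_le _ _ hxy]
    rw [h2]
    exact (hf.mono (subset_univ _)).dist_le ⟨mem_univ _, left_mem_Icc.2 hxy⟩
      ⟨mem_univ _, right_mem_Icc.2 hxy⟩
  have hdist : ∀ x y, dist (f x) (f y) ≤ dist (v x) (v y) := by
    intro x y
    rcases le_total x y with h | h
    · rw [dist_comm (v x), Real.dist_eq]
      exact (hle x y h).trans (le_abs_self _)
    · rw [dist_comm (f x), Real.dist_eq]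
      exact (hle y x h).trans (le_abs_self _)
  set g : range v → E := fun p => f p.2.choose with hg
  have hgc : Continuous g := by
    refine (LipschitzWith.of_dist_le_mul (K := 1) fun p q => ?_).continuous
    rw [NNReal.coe_one, one_mul]
    refine (hdist _ _).trans_eq ?_
    rw [p.2.choose_spec, q.2.choose_spec, Subtype.dist_eq]
  have hfg : f = g ∘ rangeFactorization v := by
    ext x
    refine dist_le_zero.1 ((hdist _ _).trans_eq ?_)
    rw [(rangeFactorization v x).2.choose_spec]
    simp
  rw [hfg]
  exact hgc.stronglyMeasurable.comp_measurable (hvm.measurable.subtype_mk)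

end BoundedVariation

/-! ### The Lebesgue-Stieltjes measure of a continuous function of bounded variation -/

namespace CBV

variable {T : ℝ} {H : Type*} [NormedAddCommGroup H]

theorem rightLim_eq (y : CBV T H) : Function.rightLim y = y := by
  ext t
  by_cases h : 𝓝[>] t = ⊥
  · exact rightLim_eq_of_eq_bot _ h
  · have : (𝓝[>] t).NeBot := ⟨h⟩
    exact rightLim_eq_of_tendsto ((y.continuous.tendsto t).mono_left nhdsWithin_le_nhds)

theorem leftLim_eq (y : CBV T H) : Function.leftLim y = y := by
  ext t
  by_cases h : 𝓝[<] t = ⊥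
  · exact leftLim_eq_of_eq_bot _ h
  · have : (𝓝[<] t).NeBot := ⟨h⟩
    exact leftLim_eq_of_tendsto ((y.continuous.tendsto t).mono_left nhdsWithin_le_nhds)

theorem Iic_eq_Icc (hT : 0 < T) (t : Icc (0 : ℝ) T) : Iic t = Icc ⟨0, le_rfl, hT.le⟩ t :=
  ext fun s => ⟨fun h => ⟨s.2.1, h⟩, fun h => h.2⟩

theorem Iic_right_eq_univ (hT : 0 < T) :
    Iic (⟨T, hT.le, le_rfl⟩ : Icc (0 : ℝ) T) = univ :=
  eq_univ_of_forall fun s => s.2.2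

variable [CompleteSpace H]

theorem D_Iic (hT : 0 < T) (y : CBV T H) (t : Icc (0 : ℝ) T) :
    y.D (Iic t) = y t - y ⟨0, le_rfl, hT.le⟩ := by
  rw [Iic_eq_Icc hT, D, BoundedVariationOn.vectorMeasure_Icc _ (by exact t.2.1), y.rightLim_eq,
    y.leftLim_eq]

theorem D_Ioc (y : CBV T H) {s t : Icc (0 : ℝ) T} (h : s ≤ t) :
    y.D (Ioc s t) = y t - y s := by
  rw [D, BoundedVariationOn.vectorMeasure_Ioc _ h, y.rightLim_eq]

theorem eq_D_of_forall_Iic (hT : 0 < T) (y : CBV T H) (m : VectorMeasure (Icc (0 : ℝ) T) H)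
    (h : ∀ t, m (Iic t) = y t - y ⟨0, le_rfl, hT.le⟩) : m = y.D := by
  refine VectorMeasure.ext_of_generateFrom (range Iic) ?_ ?_ isPiSystem_Iic ?_
  · rintro _ ⟨t, rfl⟩
    rw [h, D_Iic hT]
  · exact (BorelSpace.measurable_eq).trans (borel_eq_generateFrom_Iic _)
  · rw [← Iic_right_eq_univ hT, h, D_Iic hT]

/-- The measure `Dy` is dominated by the Stieltjes measure of the variation function of `y`. -/
theorem isFiniteMeasure_variation_D (hT : 0 < T) (y : CBV T H) :
    IsFiniteMeasure y.D.variation := by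
  have hf := y.boundedVariation
  set a : Icc (0 : ℝ) T := ⟨0, le_rfl, hT.le⟩
  have : Nonempty (Icc (0 : ℝ) T) := ⟨a⟩
  set ν := (hf.stieltjesFunctionRightLim a).measure with hν
  have : IsFiniteMeasure ν :=
    StieltjesFunction.isFiniteMeasure_of_forall_abs_le
      (C := (eVariationOn (Function.rightLim y) univ).toReal) _
      fun x => variationOnFromTo.abs_le_eVariationOn hf.rightLim
  have A : ∀ s ∈ {s | ∃ u v : Icc (0 : ℝ) T, u ≤ v ∧ s = Ioc u v},
      ‖AddContent.onIoc y s‖ₑ ≤ ν s := by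
    rintro s ⟨u, v, huv, rfl⟩
    have hl : LocallyBoundedVariationOn y univ := hf.locallyBoundedVariationOn
    rw [AddContent.onIoc_apply huv, hν, StieltjesFunction.measure_Ioc,
      BoundedVariationOn.stieltjesFunctionRightLim_apply,
      BoundedVariationOn.stieltjesFunctionRightLim_apply, y.rightLim_eq,
      ← variationOnFromTo.add hl (mem_univ a) (mem_univ u) (mem_univ v), add_sub_cancel_left,
      variationOnFromTo.eq_of_le _ _ huv, ENNReal.ofReal_toReal (hf.mono (subset_univ _)),
      ← edist_eq_enorm_sub]
    exact eVariationOn.edist_le _ ⟨mem_univ _, right_mem_Icc.2 huv⟩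
      ⟨mem_univ _, left_mem_Icc.2 huv⟩
  have B : (inferInstance : MeasurableSpace (Icc (0 : ℝ) T)) =
      MeasurableSpace.generateFrom {s | ∃ u v : Icc (0 : ℝ) T, u ≤ v ∧ s = Ioc u v} := by
    refine (BorelSpace.measurable_eq).trans ?_
    convert! borel_eq_generateFrom_Ioc_le (Icc (0 : ℝ) T) using 2
    grind only
  obtain ⟨m, hm, hmν⟩ :=
    VectorMeasure.exists_extension_of_isSetSemiring_of_le_measure_of_generateFrom
      IsSetSemiring.Ioc A B
  -- the half-open intervals do not see the left endpoint, where neither measure has an atom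
  have hbot : m {a} = 0 := by
    refine enorm_eq_zero.1 (le_bot_iff.1 ((hmν _).trans ?_))
    rw [← botSet_eq_singleton_of_isBot (show IsBot a from fun t => t.2.1)]
    simp [hν]
  have hmD : m = y.D := by
    refine eq_D_of_forall_Iic hT y m fun t => ?_
    have hat : a ≤ t := t.2.1
    rw [Iic_eq_Icc hT, ← Icc_union_Ioc_eq_Icc le_rfl hat, VectorMeasure.of_union (by simp)
      measurableSet_Icc measurableSet_Ioc, Icc_self, hbot, zero_add, hm _ ⟨a, t, hat, rfl⟩,
      AddContent.onIoc_apply hat]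
  rw [← hmD]
  exact isFiniteMeasure_of_le ν (VectorMeasure.variation_le_of_forall_enorm_le fun s _ => hmν s)

theorem integrable_of_boundedVariationOn (hT : 0 < T) (y : CBV T H) {f : Icc (0 : ℝ) T → H}
    (hf : BoundedVariationOn f univ) : y.D.Integrable f := by
  have := y.isFiniteMeasure_variation_D hT
  obtain ⟨C, hC⟩ := hf.exists_norm_le
  exact Integrable.of_bound hf.stronglyMeasurable.aestronglyMeasurable C (ae_of_all _ hC)

end CBV

/-! ### Change of variables -/

/-- A continuous nondecreasing surjection `φ` of `[0,T]` has a section which is its lower adjoint,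
namely `s ↦ min (φ ⁻¹' {s})`. -/
theorem exists_galoisConnection_section {T : ℝ} {φ : Icc (0 : ℝ) T → Icc (0 : ℝ) T}
    (hc : Continuous φ) (hm : Monotone φ) (hs : Function.Surjective φ) :
    ∃ ψ : Icc (0 : ℝ) T → Icc (0 : ℝ) T, GaloisConnection ψ φ ∧ ∀ s, φ (ψ s) = s := by
  have h : ∀ s, ∃ p, IsLeast (φ ⁻¹' {s}) p := fun s =>
    (isClosed_singleton.preimage hc).isCompact.exists_isLeast (hs s)
  choose ψ hψ using h
  refine ⟨ψ, fun s t => ⟨fun hst => ?_, fun hst => ?_⟩, fun s => (hψ s).1⟩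
  · exact (hψ s).1.symm.le.trans (hm hst)
  · by_contra! hlt
    have h1 : φ t = s := le_antisymm ((hm hlt.le).trans (hψ s).1.le) hst
    exact hlt.not_ge ((hψ s).2 h1)

namespace CBV

variable {T : ℝ} {H : Type*} [NormedAddCommGroup H] [CompleteSpace H]
  {φ ψ : Icc (0 : ℝ) T → Icc (0 : ℝ) T}

theorem map_zero_of_surjective (hT : 0 < T) (hm : Monotone φ) (hs : Function.Surjective φ) :
    φ ⟨0, le_rfl, hT.le⟩ = ⟨0, le_rfl, hT.le⟩ := by
  obtain ⟨t, ht⟩ := hs ⟨0, le_rfl, hT.le⟩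
  exact le_antisymm ((hm t.2.1).trans ht.le) (φ _).2.1

theorem D_comp (hT : 0 < T) (y : CBV T H) (hc : Continuous φ) (hm : Monotone φ)
    (hgc : GaloisConnection ψ φ) (hφψ : ∀ s, φ (ψ s) = s) :
    (y.comp φ hc hm).D = y.D.map ψ := by
  refine (eq_D_of_forall_Iic hT _ _ fun t => ?_).symm
  have h : ψ ⁻¹' Iic t = Iic (φ t) := ext fun s => hgc s t
  rw [VectorMeasure.map_apply _ hgc.monotone_l.measurable measurableSet_Iic, h, D_Iic hT]
  change _ = y (φ t) - y (φ _)
  rw [map_zero_of_surjective hT hm fun s => ⟨ψ s, hφψ s⟩]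

theorem D_eq_map_D_comp (hT : 0 < T) (y : CBV T H) (hc : Continuous φ) (hm : Monotone φ)
    (hgc : GaloisConnection ψ φ) (hφψ : ∀ s, φ (ψ s) = s) :
    y.D = (y.comp φ hc hm).D.map φ := by
  rw [y.D_comp hT hc hm hgc hφψ]
  ext s hs
  rw [VectorMeasure.map_apply _ hc.measurable hs,
    VectorMeasure.map_apply _ hgc.monotone_l.measurable (hc.measurable hs), ← preimage_comp,
    show φ ∘ ψ = id from funext hφψ, preimage_id]

theorem variation_D_eq_map (hT : 0 < T) (y : CBV T H) (hc : Continuous φ) (hm : Monotone φ)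
    (hgc : GaloisConnection ψ φ) (hφψ : ∀ s, φ (ψ s) = s) :
    y.D.variation = (y.comp φ hc hm).D.variation.map φ := by
  refine le_antisymm ?_ ?_
  · conv_lhs => rw [y.D_eq_map_D_comp hT hc hm hgc hφψ]
    exact VectorMeasure.variation_map_le
  · rw [y.D_comp hT hc hm hgc hφψ]
    refine (Measure.map_mono VectorMeasure.variation_map_le hc.measurable).trans_eq ?_
    rw [Measure.map_map hc.measurable hgc.monotone_l.measurable,
      show φ ∘ ψ = id from funext hφψ, Measure.map_id]

theorem variation_D_comp (hT : 0 < T) (y : CBV T H) (hc : Continuous φ) (hm : Monotone φ)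
    (hgc : GaloisConnection ψ φ) (hφψ : ∀ s, φ (ψ s) = s) :
    (y.comp φ hc hm).D.variation = y.D.variation.map ψ := by
  have := isFiniteMeasure_variation_D hT (y.comp φ hc hm)
  -- one inequality holds for every push-forward; the total masses agree
  refine Measure.eq_of_le_of_measure_univ_eq ?_ ?_
  · rw [y.D_comp hT hc hm hgc hφψ]
    exact VectorMeasure.variation_map_le
  · rw [Measure.map_apply hgc.monotone_l.measurable MeasurableSet.univ, preimage_univ,
      y.variation_D_eq_map hT hc hm hgc hφψ, Measure.map_apply hc.measurable MeasurableSet.univ,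
      preimage_univ]

end CBV

/-! ### A chain rule and a Gronwall inequality -/

section ChainRule

variable {T : ℝ} {H : Type*} [NormedAddCommGroup H] [InnerProductSpace ℝ H]

/-- On an interval where `w` oscillates by at most `ε`, replacing the integrand `w` by the mean of
its two endpoint values makes the integral equal to half the increment of `‖w‖ ^ 2`. -/
theorem abs_setIntegral_Ioc_sub_le (m : VectorMeasure (Icc (0 : ℝ) T) H)
    [IsFiniteMeasure m.variation] {w : Icc (0 : ℝ) T → H} (hw : Continuous w)
    (hm : ∀ s t, s ≤ t → m (Ioc s t) = w t - w s) {s t : Icc (0 : ℝ) T} (hst : s ≤ t) {ε : ℝ}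
    (hε : ∀ x ∈ Icc s t, ∀ x' ∈ Icc s t, ‖w x - w x'‖ ≤ ε) :
    |(m.restrict (Ioc s t)).integral w (innerSL ℝ) - (‖w t‖ ^ 2 - ‖w s‖ ^ 2) / 2|
      ≤ ε * m.variation.real (Ioc s t) := by
  have hwi : Integrable w m.variation :=
    hw.integrable_of_hasCompactSupport (HasCompactSupport.of_compactSpace w)
  set c : H := (1 / 2 : ℝ) • (w t + w s) with hc
  have h1 : (m.restrict (Ioc s t)).integral (fun _ => c) (innerSL ℝ)
      = (‖w t‖ ^ 2 - ‖w s‖ ^ 2) / 2 := by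
    rw [VectorMeasure.setIntegral_const, hm s t hst, innerSL_apply_apply, hc, inner_smul_left,
      inner_add_left, inner_sub_right, inner_sub_right, real_inner_self_eq_norm_sq,
      real_inner_self_eq_norm_sq, real_inner_comm (w s) (w t)]
    simp
    ring
  have hws : VectorMeasure.Integrable (m.restrict (Ioc s t)) w :=
    VectorMeasure.Integrable.restrict hwi
  rw [← h1, ← VectorMeasure.integral_fun_sub hws (integrable_const c), ← Real.norm_eq_abs]
  have hε0 : 0 ≤ ε := (norm_nonneg _).trans (hε s (left_mem_Icc.2 hst) s (left_mem_Icc.2 hst))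
  refine (VectorMeasure.norm_setIntegral_le_of_norm_le_const (C := ε) fun x hx => ?_).trans ?_
  · have hx' : x ∈ Icc s t := Ioc_subset_Icc_self hx
    have h2 : w x - c = (1 / 2 : ℝ) • ((w x - w t) + (w x - w s)) := by
      rw [hc]
      module
    rw [h2, norm_smul]
    have h3 := norm_add_le (w x - w t) (w x - w s)
    have h4 := hε x hx' t (right_mem_Icc.2 hst)
    have h5 := hε x hx' s (left_mem_Icc.2 hst)
    norm_num
    linarith
  · have h6 : ‖innerSL ℝ (E := H)‖ ≤ 1 := norm_innerSL_le ℝ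
    have h7 : 0 ≤ m.variation.real (Ioc s t) := measureReal_nonneg
    exact mul_le_mul_of_nonneg_right (mul_le_of_le_one_right hε0 h6) h7

/-- The chain rule `⟨w, Dw⟩ = D(‖w‖ ^ 2 / 2)` for a continuous function `w`, whose differential
measure is given by its values on half-open intervals. -/
theorem setIntegral_Ioc_inner_self (hT : 0 < T) (m : VectorMeasure (Icc (0 : ℝ) T) H)
    [IsFiniteMeasure m.variation] {w : Icc (0 : ℝ) T → H} (hw : Continuous w)
    (hm : ∀ s t, s ≤ t → m (Ioc s t) = w t - w s) {s t : Icc (0 : ℝ) T} (hst : s ≤ t) :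
    (m.restrict (Ioc s t)).integral w (innerSL ℝ) = (‖w t‖ ^ 2 - ‖w s‖ ^ 2) / 2 := by
  have hwi : m.Integrable w :=
    hw.integrable_of_hasCompactSupport (HasCompactSupport.of_compactSpace w)
  have key : ∀ ε > 0,
      |(m.restrict (Ioc s t)).integral w (innerSL ℝ) - (‖w t‖ ^ 2 - ‖w s‖ ^ 2) / 2|
        ≤ ε * m.variation.real (Ioc s t) := by
    intro ε hε
    obtain ⟨τ, hτ0, hτm, ⟨N, hN⟩, hτ⟩ := exists_monotone_Icc_subset_open_cover_Icc hT.le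
      (c := fun p : Icc (0 : ℝ) T => {x | ‖w x - w p‖ < ε / 2})
      (fun p => isOpen_lt (hw.sub continuous_const).norm continuous_const)
      (fun x _ => mem_iUnion.2 ⟨x, by simpa using hε⟩)
    -- clamp the subdivision of `[0,T]` to `[s,t]`
    set σ : ℕ → Icc (0 : ℝ) T := fun n => max s (min (τ n) t) with hσ
    have hσm : Monotone σ := fun i j hij => max_le_max le_rfl (min_le_min (hτm hij) le_rfl)
    have hσ0 : σ 0 = s := max_eq_left ((min_le_left _ _).trans (by
      rw [← Subtype.coe_le_coe, hτ0]; exact s.2.1))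
    have hσN : σ N = t := by
      have h : t ≤ τ N := by
        rw [← Subtype.coe_le_coe, hN N le_rfl]; exact t.2.2
      simp only [hσ, min_eq_right h, max_eq_right hst]
    have hstep : ∀ n, ∀ x ∈ Icc (σ n) (σ (n + 1)), ∀ x' ∈ Icc (σ n) (σ (n + 1)),
        ‖w x - w x'‖ ≤ ε := by
      intro n
      rcases (hσm n.le_succ).eq_or_lt with h | h
      · rw [Nat.succ_eq_add_one] at h
        rw [← h, Icc_self]
        rintro x rfl x' rfl
        simpa using hε.le
      · have hsub : Icc (σ n) (σ (n + 1)) ⊆ Icc (τ n) (τ (n + 1)) := by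
          have h' : max s (min (τ n) t) < max s (min (τ (n + 1)) t) := h
          refine Icc_subset_Icc ?_ ?_ <;> simp only [hσ] <;> grind
        obtain ⟨p, hp⟩ := hτ n
        intro x hx x' hx'
        have h1 : ‖w x - w p‖ < ε / 2 := hp (hsub hx)
        have h2 : ‖w x' - w p‖ < ε / 2 := hp (hsub hx')
        rw [← sub_sub_sub_cancel_right _ _ (w p)]
        linarith [norm_sub_le (w x - w p) (w x' - w p)]
    have hsum : ∀ n,
        |(m.restrict (Ioc (σ 0) (σ n))).integral w (innerSL ℝ)
            - (‖w (σ n)‖ ^ 2 - ‖w (σ 0)‖ ^ 2) / 2|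
          ≤ ε * m.variation.real (Ioc (σ 0) (σ n)) := by
      intro n
      induction n with
      | zero => simp
      | succ n ih =>
        have h0 := hσm n.zero_le
        have h1 := hσm n.le_succ
        rw [Nat.succ_eq_add_one] at h1
        have hd : Disjoint (Ioc (σ 0) (σ n)) (Ioc (σ n) (σ (n + 1))) :=
          Ioc_disjoint_Ioc_of_le le_rfl
        rw [← Ioc_union_Ioc_eq_Ioc h0 h1, VectorMeasure.setIntegral_union hd measurableSet_Ioc
          measurableSet_Ioc (VectorMeasure.Integrable.restrict hwi)
          (VectorMeasure.Integrable.restrict hwi), measureReal_union hd measurableSet_Ioc]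
        have h2 := abs_setIntegral_Ioc_sub_le m hw hm h1 (hstep n)
        rw [abs_le] at ih h2 ⊢
        constructor <;> linarith [ih.1, ih.2, h2.1, h2.2]
    have h := hsum N
    rwa [hσ0, hσN] at h
  refine sub_eq_zero.1 (abs_eq_zero.1 (le_antisymm (le_of_forall_pos_le_add fun δ hδ => ?_)
    (abs_nonneg _)))
  have hV : 0 ≤ m.variation.real (Ioc s t) := measureReal_nonneg
  refine (key (δ / (m.variation.real (Ioc s t) + 1)) (by positivity)).trans ?_
  rw [zero_add, div_mul_eq_mul_div, div_le_iff₀ (by positivity)]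
  nlinarith

end ChainRule

/-- A Gronwall inequality with respect to an arbitrary finite measure. Atoms are harmless, because
the intervals `(s, t]` exclude their left endpoint. -/
theorem eq_zero_of_sub_le_setIntegral_Ioc {T : ℝ} {μ : Measure (Icc (0 : ℝ) T)} [IsFiniteMeasure μ]
    {f : Icc (0 : ℝ) T → ℝ} (hf : Continuous f) (hf0 : ∀ x, 0 ≤ f x) {a b : Icc (0 : ℝ) T}
    (ha : f a = 0)
    (h : ∀ s t, a ≤ s → s ≤ t → t ≤ b → f t - f s ≤ ∫ x in Ioc s t, f x ∂μ)
    {t : Icc (0 : ℝ) T} (hat : a ≤ t) (htb : t ≤ b) : f t = 0 := by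
  by_contra hft
  -- `p` is the last zero of `f` before `t`
  obtain ⟨p, ⟨⟨hap, hpt⟩, hp0⟩, hmax⟩ : ∃ p, IsGreatest (Icc a t ∩ f ⁻¹' {0}) p :=
    (isCompact_Icc.inter_right (isClosed_singleton.preimage hf)).exists_isGreatest
      ⟨a, left_mem_Icc.2 hat, ha⟩
  have hp0 : f p = 0 := hp0
  have hlt : p < t := lt_of_le_of_ne hpt fun h => hft (h ▸ hp0)
  obtain ⟨u, hu, hut, hulim⟩ := exists_seq_strictAnti_tendsto' hlt
  have hempty : ⋂ n, Ioc p (u n) = ∅ := by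
    refine eq_empty_of_forall_notMem fun x hx => ?_
    rw [mem_iInter] at hx
    exact (hx 0).1.not_ge (ge_of_tendsto' hulim fun n => (hx n).2)
  have hlim : Filter.Tendsto (fun n => μ (Ioc p (u n))) Filter.atTop (𝓝 0) := by
    have h := tendsto_measure_iInter_atTop (μ := μ) (s := fun n => Ioc p (u n))
      (fun n => measurableSet_Ioc.nullMeasurableSet)
      (fun i j hij => Ioc_subset_Ioc_right (hu.antitone hij)) ⟨0, measure_ne_top _ _⟩
    rwa [hempty, measure_empty] at h
  obtain ⟨n, hn⟩ := (hlim.eventually (gt_mem_nhds (show (0 : ENNReal) < 2⁻¹ by simp))).exists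
  have hpu : p ≤ u n := (hut n).1.le
  -- a maximum of `f` on `[p, u n]` is at most half of itself
  obtain ⟨q, hq, hqmax⟩ := isCompact_Icc.exists_isMaxOn ⟨p, left_mem_Icc.2 hpu⟩ hf.continuousOn
  have hqt : q ≤ t := hq.2.trans (hut n).2.le
  have h1 := h p q hap hq.1 (hqt.trans htb)
  have h2 : ∫ x in Ioc p q, f x ∂μ ≤ f q * μ.real (Ioc p q) := by
    have hfi : Integrable f μ :=
      hf.integrable_of_hasCompactSupport (HasCompactSupport.of_compactSpace f)
    refine (setIntegral_mono_on hfi.integrableOn (integrable_const (f q)).integrableOn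
      measurableSet_Ioc fun x hx => hqmax ⟨hx.1.le, hx.2.trans hq.2⟩).trans_eq ?_
    rw [setIntegral_const, smul_eq_mul, mul_comm]
  have h3 : μ.real (Ioc p q) ≤ 1 / 2 := by
    refine (measureReal_mono (Ioc_subset_Ioc_right hq.2)).trans ?_
    have := ENNReal.toReal_mono (by simp) hn.le
    simpa [Measure.real] using this
  have h4 : f q = 0 := le_antisymm (by nlinarith [hf0 q]) (hf0 q)
  have h5 : f (u n) = 0 := le_antisymm ((hqmax (right_mem_Icc.2 hpu)).trans_eq h4) (hf0 _)
  exact (hut n).1.not_ge (hmax ⟨⟨hap.trans hpu, (hut n).2.le⟩, h5⟩)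

/-! ### Uniqueness for the play problem -/

section Uniqueness

variable {T : ℝ} {hT : 0 < T} {H : Type*} [NormedAddCommGroup H] [InnerProductSpace ℝ H]
  [CompleteSpace H] {r : ℝ} {Z : Set H} {u y : CBV T H} {z₀ : H}

open Classical in
/-- The variational inequality localizes to half-open intervals: a competitor may be prescribed on
`(s, t]` only, since it can be extended by the admissible function `u - y`. -/
theorem IsPlaySolution.setIntegral_Ioc_le (hy : IsPlaySolution hT r Z u z₀ y)
    {x : Icc (0 : ℝ) T → H} (hx : BoundedVariationOn x univ) {s t : Icc (0 : ℝ) T}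
    (hxZ : ∀ p ∈ Ioc s t, x p ∈ Z) :
    (y.D.restrict (Ioc s t)).integral (fun p => x p - u p + y p) (innerSL ℝ)
      ≤ 1 / (2 * r) * ∫ p in Ioc s t, ‖x p - u p + y p‖ ^ 2 ∂y.D.variation := by
  have hz := hy.variational_ineq ((Ioc s t).piecewise x fun p => u p - y p)
    (hx.piecewise_Ioc (u.boundedVariation.fun_sub y.boundedVariation) s t) fun p => by
      by_cases hp : p ∈ Ioc s t
      · rw [piecewise_eq_of_mem _ _ _ hp]
        exact hxZ p hp
      · rw [piecewise_eq_of_notMem _ _ _ hp]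
        exact hy.constraint p
  have h1 : (fun p => (Ioc s t).piecewise x (fun p => u p - y p) p - u p + y p)
      = (Ioc s t).indicator fun p => x p - u p + y p := by
    ext p
    by_cases hp : p ∈ Ioc s t
    · rw [piecewise_eq_of_mem _ _ _ hp, indicator_of_mem hp]
    · rw [piecewise_eq_of_notMem _ _ _ hp, indicator_of_notMem hp]
      abel
  have h2 : (fun p => ‖(Ioc s t).piecewise x (fun p => u p - y p) p - u p + y p‖ ^ 2)
      = (Ioc s t).indicator fun p => ‖x p - u p + y p‖ ^ 2 := by
    ext p
    rw [congrFun h1 p]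
    by_cases hp : p ∈ Ioc s t
    · rw [indicator_of_mem hp, indicator_of_mem hp]
    · rw [indicator_of_notMem hp, indicator_of_notMem hp, norm_zero, sq, mul_zero]
  rwa [h1, h2, VectorMeasure.integral_indicator measurableSet_Ioc,
    MeasureTheory.integral_indicator measurableSet_Ioc] at hz

/-- Two functions which satisfy the variational inequality against each other and agree at `a`
agree on `[a, b]`: adding the inequalities and applying the chain rule to `y₁ - y₂` gives a Gronwall
inequality for `‖y₁ - y₂‖ ^ 2`. -/
theorem CBV.eq_of_setIntegral_Ioc_le (hT : 0 < T) (hr : 0 < r) {y₁ y₂ : CBV T H}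
    {a b : Icc (0 : ℝ) T} (ha : y₁ a = y₂ a)
    (h₁ : ∀ s t, a ≤ s → t ≤ b →
      (y₁.D.restrict (Ioc s t)).integral (fun p => y₁ p - y₂ p) (innerSL ℝ)
        ≤ 1 / (2 * r) * ∫ p in Ioc s t, ‖y₁ p - y₂ p‖ ^ 2 ∂y₁.D.variation)
    (h₂ : ∀ s t, a ≤ s → t ≤ b →
      (y₂.D.restrict (Ioc s t)).integral (fun p => y₂ p - y₁ p) (innerSL ℝ)
        ≤ 1 / (2 * r) * ∫ p in Ioc s t, ‖y₂ p - y₁ p‖ ^ 2 ∂y₂.D.variation)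
    {t : Icc (0 : ℝ) T} (hat : a ≤ t) (htb : t ≤ b) : y₁ t = y₂ t := by
  have := y₁.isFiniteMeasure_variation_D hT
  have := y₂.isFiniteMeasure_variation_D hT
  set w : Icc (0 : ℝ) T → H := fun p => y₁ p - y₂ p with hw
  have hwc : Continuous w := y₁.continuous.sub y₂.continuous
  have hwi : ∀ (μ : Measure (Icc (0 : ℝ) T)) [IsFiniteMeasure μ], Integrable w μ := fun μ _ =>
    hwc.integrable_of_hasCompactSupport (HasCompactSupport.of_compactSpace w)
  set f : Icc (0 : ℝ) T → ℝ := fun p => ‖w p‖ ^ 2 with hfdef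
  have hfc : Continuous f := hwc.norm.pow 2
  have hfi : ∀ (μ : Measure (Icc (0 : ℝ) T)) [IsFiniteMeasure μ], Integrable f μ := fun μ _ =>
    hfc.integrable_of_hasCompactSupport (HasCompactSupport.of_compactSpace f)
  have : IsFiniteMeasure (y₁.D - y₂.D).variation :=
    isFiniteMeasure_of_le _ VectorMeasure.variation_sub_le
  set μ : Measure (Icc (0 : ℝ) T) := (1 / r).toNNReal • (y₁.D.variation + y₂.D.variation) with hμ
  have hf0 : f t = 0 := by
    refine eq_zero_of_sub_le_setIntegral_Ioc (μ := μ) hfc (fun x => sq_nonneg _)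
      (a := a) (b := b) ?_ ?_ hat htb
    · simp [hfdef, hw, ha]
    intro p q hap hpq hqb
    have hc := setIntegral_Ioc_inner_self hT (y₁.D - y₂.D) hwc (fun p q hpq => by
      rw [sub_apply, y₁.D_Ioc hpq, y₂.D_Ioc hpq, sub_sub_sub_comm]) hpq
    rw [← VectorMeasure.integral_indicator measurableSet_Ioc,
      VectorMeasure.integral_sub_vectorMeasure ((hwi _).indicator measurableSet_Ioc)
        ((hwi _).indicator measurableSet_Ioc), VectorMeasure.integral_indicator measurableSet_Ioc,
      VectorMeasure.integral_indicator measurableSet_Ioc] at hc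
    have e₁ := h₁ p q hap hqb
    have e₂ := h₂ p q hap hqb
    simp only [← neg_sub (y₁ _) (y₂ _), norm_neg] at e₂
    rw [VectorMeasure.integral_fun_neg] at e₂
    have hint : ∫ x in Ioc p q, f x ∂μ = 1 / r * (∫ x in Ioc p q, f x ∂y₁.D.variation
        + ∫ x in Ioc p q, f x ∂y₂.D.variation) := by
      rw [hμ, Measure.restrict_smul, integral_smul_nnreal_measure, Measure.restrict_add,
        integral_add_measure (hfi _) (hfi _), NNReal.smul_def, Real.coe_toNNReal _ (by positivity),
        smul_eq_mul]
    have hr2 : 1 / r = 2 * (1 / (2 * r)) := by field_simp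
    rw [hint, hr2]
    change _ ≤ 1 / (2 * r) * ∫ x in Ioc p q, f x ∂y₁.D.variation at e₁
    change _ ≤ 1 / (2 * r) * ∫ x in Ioc p q, f x ∂y₂.D.variation at e₂
    simp only [hfdef] at *
    linarith
  exact sub_eq_zero.1 (norm_eq_zero.1 (pow_eq_zero_iff two_ne_zero |>.1 hf0))

theorem IsPlaySolution.unique (hr : 0 < r) {y' : CBV T H} (hy : IsPlaySolution hT r Z u z₀ y)
    (hy' : IsPlaySolution hT r Z u z₀ y') : y = y' := by
  refine CBV.ext (funext fun t => ?_)
  have key : ∀ {y y' : CBV T H}, IsPlaySolution hT r Z u z₀ y → IsPlaySolution hT r Z u z₀ y' →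
      ∀ s t : Icc (0 : ℝ) T,
        (y.D.restrict (Ioc s t)).integral (fun p => y p - y' p) (innerSL ℝ)
          ≤ 1 / (2 * r) * ∫ p in Ioc s t, ‖y p - y' p‖ ^ 2 ∂y.D.variation := by
    intro y y' hy hy' s t
    have h := hy.setIntegral_Ioc_le (u.boundedVariation.fun_sub y'.boundedVariation) (s := s)
      (t := t) fun p _ => hy'.constraint p
    have e : ∀ p, u p - y' p - u p + y p = y p - y' p := fun p => by abel
    simpa only [e] using h
  refine CBV.eq_of_setIntegral_Ioc_le hT hr (a := ⟨0, le_rfl, hT.le⟩) (b := t) ?_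
    (fun s t _ _ => key hy hy' s t) (fun s t _ _ => key hy' hy s t) t.2.1 le_rfl
  exact sub_right_injective (hy.initial.trans hy'.initial.symm)

/-- A solution is at rest as long as its input is: it is compared with a constant function, whose
differential measure vanishes. -/
theorem IsPlaySolution.eq_of_input_eq (hr : 0 < r) (hy : IsPlaySolution hT r Z u z₀ y)
    {a b : Icc (0 : ℝ) T} (hab : a ≤ b) (hu : ∀ p, a ≤ p → p ≤ b → u p = u a) : y b = y a := by
  let c : CBV T H := ⟨fun _ => y a, continuous_const, boundedVariationOn_const _ _⟩
  have hD : c.D = 0 := (CBV.eq_D_of_forall_Iic hT c 0 fun t => by simp [c]).symm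
  refine CBV.eq_of_setIntegral_Ioc_le hT hr (y₁ := y) (y₂ := c) (a := a) (b := b) rfl ?_ ?_ hab
    le_rfl
  · intro s t has htb
    have h := hy.setIntegral_Ioc_le (s := s) (t := t)
      (x := fun p => u a - c p)
      ((boundedVariationOn_const _ _).fun_sub c.boundedVariation) fun p _ => hy.constraint a
    have e : EqOn (fun p => u a - c p - u p + y p) (fun p => y p - c p) (Ioc s t) := fun p hp => by
      simp only [hu p (has.trans hp.1.le) (hp.2.trans htb)]
      abel
    rwa [VectorMeasure.setIntegral_congr_fun e, setIntegral_congr_fun measurableSet_Ioc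
      (g := fun p => ‖y p - c p‖ ^ 2) fun p hp => by simp only [e hp]] at h
  · intro s t _ _
    simp [hD]

end Uniqueness

/-! ### Reparametrization of solutions -/

section Reparametrization

variable {T : ℝ} {hT : 0 < T} {H : Type*} [NormedAddCommGroup H] [InnerProductSpace ℝ H]
  [CompleteSpace H] {r : ℝ} {Z : Set H} {u y : CBV T H} {z₀ : H}
  {φ : Icc (0 : ℝ) T → Icc (0 : ℝ) T}

/-- Composing with `φ` preserves solutions: as `D(y ∘ φ)` is the image of `Dy` under the section
`ψ` of `φ`, testing `y ∘ φ` with `z` amounts to testing `y` with `z ∘ ψ`. -/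
theorem IsPlaySolution.comp (hy : IsPlaySolution hT r Z u z₀ y) (hc : Continuous φ)
    (hm : Monotone φ) (hs : Function.Surjective φ) :
    IsPlaySolution hT r Z (u.comp φ hc hm) z₀ (y.comp φ hc hm) := by
  obtain ⟨ψ, hgc, hφψ⟩ := exists_galoisConnection_section hc hm hs
  have hψ : Monotone ψ := hgc.monotone_l
  refine ⟨fun t => hy.constraint (φ t), fun z hz hzZ => ?_, ?_⟩
  · have hbv : BoundedVariationOn (fun t => z t - (u.comp φ hc hm) t + (y.comp φ hc hm) t) univ :=
      (hz.fun_sub (u.comp φ hc hm).boundedVariation).fun_add (y.comp φ hc hm).boundedVariation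
    have h := hy.variational_ineq (z ∘ ψ) (hz.comp_monotone hψ) fun t => hzZ _
    have e : ∀ s, z (ψ s) - (u.comp φ hc hm) (ψ s) + (y.comp φ hc hm) (ψ s)
        = (z ∘ ψ) s - u s + y s := fun s => by
      change z (ψ s) - u (φ (ψ s)) + y (φ (ψ s)) = _
      rw [hφψ]
      rfl
    rw [y.variation_D_comp hT hc hm hgc hφψ, y.D_comp hT hc hm hgc hφψ,
      VectorMeasure.integral_map hψ.measurable hbv.stronglyMeasurable.aestronglyMeasurable
        (y.integrable_of_boundedVariationOn hT (hbv.comp_monotone hψ)),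
      integral_map (f := fun t => ‖z t - (u.comp φ hc hm) t + (y.comp φ hc hm) t‖ ^ 2)
        hψ.measurable.aemeasurable
        (hbv.stronglyMeasurable.norm.pow 2).aestronglyMeasurable]
    simpa only [e] using h
  · change u (φ _) - y (φ _) = z₀
    rw [CBV.map_zero_of_surjective hT hm hs]
    exact hy.initial

/-- Conversely, `y` is a solution if `y ∘ φ` is: testing `y` with `z` amounts to testing `y ∘ φ`
with `z ∘ φ`. -/
theorem IsPlaySolution.of_comp {hc : Continuous φ} {hm : Monotone φ}
    (hy : IsPlaySolution hT r Z (u.comp φ hc hm) z₀ (y.comp φ hc hm))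
    (hs : Function.Surjective φ) : IsPlaySolution hT r Z u z₀ y := by
  obtain ⟨ψ, hgc, hφψ⟩ := exists_galoisConnection_section hc hm hs
  refine ⟨fun t => ?_, fun z hz hzZ => ?_, ?_⟩
  · rw [← hφψ t]
    exact hy.constraint (ψ t)
  · have hbv : BoundedVariationOn (fun t => z t - u t + y t) univ :=
      (hz.fun_sub u.boundedVariation).fun_add y.boundedVariation
    have h := hy.variational_ineq (z ∘ φ) (hz.comp_monotone hm) fun t => hzZ _
    rw [y.variation_D_eq_map hT hc hm hgc hφψ, y.D_eq_map_D_comp hT hc hm hgc hφψ,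
      VectorMeasure.integral_map hc.measurable hbv.stronglyMeasurable.aestronglyMeasurable
        ((y.comp φ hc hm).integrable_of_boundedVariationOn hT (hbv.comp_monotone hm)),
      integral_map (f := fun t => ‖z t - u t + y t‖ ^ 2) hc.measurable.aemeasurable
        (hbv.stronglyMeasurable.norm.pow 2).aestronglyMeasurable]
    exact h
  · have h := hy.initial
    change u (φ _) - y (φ _) = z₀ at h
    rwa [CBV.map_zero_of_surjective hT hm hs] at h

/-- Every solution for the input `u ∘ φ` is constant on the level sets of `φ`, hence factors
through `φ`. -/
theorem IsPlaySolution.exists_eq_comp (hr : 0 < r) {hc : Continuous φ} {hm : Monotone φ}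
    (hy : IsPlaySolution hT r Z (u.comp φ hc hm) z₀ y) (hs : Function.Surjective φ) :
    ∃ y' : CBV T H, y = y'.comp φ hc hm := by
  obtain ⟨ψ, hgc, hφψ⟩ := exists_galoisConnection_section hc hm hs
  have hlevel : y ∘ ψ ∘ φ = y := by
    ext t
    refine (hy.eq_of_input_eq hr (hgc.l_u_le t) fun p h1 h2 => ?_).symm
    change u (φ p) = u (φ (ψ (φ t)))
    rw [hφψ, le_antisymm (hm h2) ((hφψ (φ t)).symm.le.trans (hm h1))]
  have hq : Topology.IsQuotientMap φ := hc.isClosedMap.isQuotientMap hc hs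
  refine ⟨⟨y ∘ ψ, hq.continuous_iff.2 ?_, y.boundedVariation.comp_monotone hgc.monotone_l⟩,
    CBV.ext hlevel.symm⟩
  rw [Function.comp_assoc, hlevel]
  exact y.continuous

theorem IsPlaySolution.play_eq (hr : 0 < r) {z₀ : Z} (hy : IsPlaySolution hT r Z u z₀ y) :
    play hT r Z u z₀ = y := by
  have h : ∃! y, IsPlaySolution hT r Z u z₀ y := ⟨y, hy, fun y' hy' => hy'.unique hr hy⟩
  rw [play, dif_pos h]
  exact h.choose_spec.1.unique hr hy

end Reparametrization

theorem mainTheorem3 {H : Type*} [NormedAddCommGroup H] [InnerProductSpace ℝ H]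
    [CompleteSpace H] [Nontrivial H] (r : ℝ) (Z : Set H) (hZ : IsProxRegular r Z)
    (T : ℝ) (hT : 0 < T) (u : CBV T H) (z₀ : Z)
    (φ : Icc (0 : ℝ) T → Icc (0 : ℝ) T) (hφc : Continuous φ) (hφm : Monotone φ)
    (hφs : Function.Surjective φ) :
    (∀ y : CBV T H, IsPlaySolution hT r Z u z₀ y →
      play hT r Z u z₀ = y ∧
        IsPlaySolution hT r Z (u.comp φ hφc hφm) z₀ (y.comp φ hφc hφm)) ∧
    play hT r Z (u.comp φ hφc hφm) z₀ = (play hT r Z u z₀).comp φ hφc hφm := by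
  refine ⟨fun y hy => ⟨hy.play_eq hZ.pos, hy.comp hφc hφm hφs⟩, ?_⟩
  by_cases h : ∃ y, IsPlaySolution hT r Z u z₀ y
  · obtain ⟨y, hy⟩ := h
    rw [hy.play_eq hZ.pos, (hy.comp hφc hφm hφs).play_eq hZ.pos]
  · -- the problems for `u` and `u ∘ φ` are solvable simultaneously
    have h' : ¬ ∃ y, IsPlaySolution hT r Z (u.comp φ hφc hφm) z₀ y := by
      rintro ⟨y, hy⟩
      obtain ⟨y', rfl⟩ := hy.exists_eq_comp hZ.pos hφs
      exact h ⟨y', hy.of_comp hφs⟩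
    rw [play, play, dif_neg fun e => h' e.exists, dif_neg fun e => h e.exists]
    rfl
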